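/- Let $C=[0,1]^3$ be the unit cube with its faces labelled $F_1,\dots,F_6$ so that $F_n$ and $F_m$ are opposite exactly when $n+m=7$, and so that, seen from outside with $F_1$ in front, $F_2,F_3,F_4,F_5$ are respectively below, left of, right of and above $F_1$. For $p_1,p_2\in\partial C$ the surface distance $d(p_1,p_2)$ is the length of a shortest path from $p_1$ to $p_2$ on $\partial C$. If $F_n$ and $F_m$ are adjacent faces (distinct and not opposite), we write $p=(F_n,F_m,x,y)$ when $p\in F_n$ and $p$ has coordinates $(x,y)$ after $F_n$, seen from outside the cube, is placed isometrically (preserving orientation) onto $[0,1]^2$ with the edge $F_n\cap F_m$ on the bottom side $[0,1]\times\{0\}$. Let $p_1,p_2$ be two distinct points on the surface of the cube. (1) If $p_1\in F_n\setminus F_m$ and $p_2\in F_m\setminus F_n$ with $n\ne m$ and $n+m\neq 7$, and $p_1=(F_n,F_m,x_1,y_1)$, $p_2=(F_m,F_n,x_2,y_2)$, then a shortest path exists and $d(p_1,p_2)$ is the minimum of the three numbers $$\sqrt{(x_1+x_2-1)^2+(y_1+y_2)^2},\quad \sqrt{(x_1+y_2)^2+(y_1-x_2+1)^2},\quad \sqrt{(x_1-y_2-1)^2+(y_1+x_2)^2}.$$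 (2) If $p_1$ and $p_2$ are in the interiors of $F_n$ and $F_m$ with $n+m=7$, and $F_k$ is any face adjacent to both, with $p_1=(F_n,F_k,x_1,y_1)$ and $p_2=(F_m,F_k,x_2,y_2)$, then a shortest path exists and $d(p_1,p_2)$ is the minimum of the twelve numbers $$\begin{aligned} &\sqrt{(x_1+x_2-1)^2+(y_1+y_2+1)^2}, && \sqrt{(y_1-y_2)^2+(x_1-x_2+2)^2},\\ &\sqrt{(y_1-y_2)^2+(x_1-x_2-2)^2}, && \sqrt{(x_1+x_2-1)^2+(y_1+y_2-3)^2},\\ &\sqrt{(x_1+y_2)^2+(y_1-x_2+2)^2}, && \sqrt{(y_1+x_2-2)^2+(x_1-y_2+2)^2},\\ &\sqrt{(x_1+y_2-2)^2+(y_1-x_2-2)^2}, && \sqrt{(y_1+x_2)^2+(x_1-y_2-2)^2},\\ &\sqrt{(x_1-y_2-1)^2+(y_1+x_2+1)^2}, && \sqrt{(y_1-x_2+1)^2+(x_1+y_2+1)^2},\\ &\sqrt{(x_1-y_2+1)^2+(y_1+x_2-3)^2}, && \sqrt{(y_1-x_2-1)^2+(x_1+y_2-3)^2}. \end{aligned}$$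 -/

import Mathlib

open scoped Matrix ENNReal

/-- Euclidean three-space. -/
abbrev Space3 : Type := EuclideanSpace ℝ (Fin 3)

/-- The six faces of the unit cube `[0,1]³`. -/
inductive CubeFace : Type
  | F1 | F2 | F3 | F4 | F5 | F6

namespace CubeFace

/-- The number of a face. Opposite faces are those whose numbers sum to `7`. -/
def label : CubeFace → ℕ
  | F1 => 1
  | F2 => 2
  | F3 => 3
  | F4 => 4
  | F5 => 5
  | F6 => 6

/-- The outward unit normal of a face. Looking at the cube from outside with `F1` in front, the
neighbours of `F1` are `F2` below, `F3` on the left, `F4` on the right and `F5` above. -/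
noncomputable def normal : CubeFace → Fin 3 → ℝ
  | F1 => ![0, 0, 1]
  | F2 => ![0, -1, 0]
  | F3 => ![-1, 0, 0]
  | F4 => ![1, 0, 0]
  | F5 => ![0, 1, 0]
  | F6 => ![0, 0, -1]

/-- The vector from the centre of the cube to `p`. -/
noncomputable def fromCentre (p : Space3) : Fin 3 → ℝ := fun i => p i - 1 / 2

/-- The face as a closed unit square in space. -/
def carrier (n : CubeFace) : Set Space3 :=
  {p | (∀ i, p i ∈ Set.Icc (0 : ℝ) 1) ∧ n.normal ⬝ᵥ fromCentre p = 1 / 2}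

/-- The interior of a face: its points that lie on none of its edges, that is, on no other face. -/
def interior (n : CubeFace) : Set Space3 :=
  {p | p ∈ n.carrier ∧ ∀ m : CubeFace, m ≠ n → p ∉ m.carrier}

/-- Two faces are adjacent when they are distinct and not opposite (they then share an edge). -/
def Adjacent (n m : CubeFace) : Prop := n ≠ m ∧ n.label + m.label ≠ 7

/-- `p = (F_n, F_m, x, y)`: the point `p` has home-face `n`, shared-face `m` (adjacent to `n`), and
coordinates `(x, y)` in `n`. Seen from outside the cube, `n` is placed in the upper half-plane with
its edge shared with `m` at the bottom, running from `(0,0)` to `(1,0)`. So `y` increases in the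
direction `-ν_m` away from `m`, and `x` in the direction `ν_n × ν_m`, which completes the triple
`(ν_n × ν_m, -ν_m, ν_n)` to a right-handed orthonormal frame. -/
def Represents (p : Space3) (n m : CubeFace) (x y : ℝ) : Prop :=
  Adjacent n m ∧ p ∈ n.carrier ∧
    x = 1 / 2 + (n.normal ⨯₃ m.normal) ⬝ᵥ fromCentre p ∧
    y = 1 / 2 - m.normal ⬝ᵥ fromCentre p

end CubeFace

/-- The surface of the unit cube. -/
def cubeSurface : Set Space3 := ⋃ n : CubeFace, n.carrier

/-- The set of lengths of the continuous paths from `p` to `q` that stay on the surface of the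
cube. The length of a path is its total variation (`∞` for a non-rectifiable path). -/
noncomputable def surfacePathLengths (p q : Space3) : Set ℝ≥0∞ :=
  {ℓ | ∃ γ : Path p q, (∀ t, γ t ∈ cubeSurface) ∧ eVariationOn γ Set.univ = ℓ}

/-- The surface distance. -/
noncomputable def surfaceDist (p q : Space3) : ℝ≥0∞ := sInf (surfacePathLengths p q)

/-- The minimum of the trail lengths in the landscapes `L₁, L₂, L₃` between adjacent faces. -/
noncomputable def adjacentTrailMin (x₁ y₁ x₂ y₂ : ℝ) : ℝ :=
  min (√((x₁ + x₂ - 1) ^ 2 + (y₁ + y₂) ^ 2)) <|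
  min (√((x₁ + y₂) ^ 2 + (y₁ - x₂ + 1) ^ 2))
      (√((x₁ - y₂ - 1) ^ 2 + (y₁ + x₂) ^ 2))

/-- The minimum of the trail lengths in the landscapes `L₄, …, L₁₅` between opposite faces. -/
noncomputable def oppositeTrailMin (x₁ y₁ x₂ y₂ : ℝ) : ℝ :=
  min (√((x₁ + x₂ - 1) ^ 2 + (y₁ + y₂ + 1) ^ 2)) <|
  min (√((y₁ - y₂) ^ 2 + (x₁ - x₂ + 2) ^ 2)) <|
  min (√((y₁ - y₂) ^ 2 + (x₁ - x₂ - 2) ^ 2)) <|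
  min (√((x₁ + x₂ - 1) ^ 2 + (y₁ + y₂ - 3) ^ 2)) <|
  min (√((x₁ + y₂) ^ 2 + (y₁ - x₂ + 2) ^ 2)) <|
  min (√((y₁ + x₂ - 2) ^ 2 + (x₁ - y₂ + 2) ^ 2)) <|
  min (√((x₁ + y₂ - 2) ^ 2 + (y₁ - x₂ - 2) ^ 2)) <|
  min (√((y₁ + x₂) ^ 2 + (x₁ - y₂ - 2) ^ 2)) <|
  min (√((x₁ - y₂ - 1) ^ 2 + (y₁ + x₂ + 1) ^ 2)) <|
  min (√((y₁ - x₂ + 1) ^ 2 + (x₁ + y₂ + 1) ^ 2)) <|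
  min (√((x₁ - y₂ + 1) ^ 2 + (y₁ + x₂ - 3) ^ 2))
      (√((y₁ - x₂ - 1) ^ 2 + (x₁ + y₂ - 3) ^ 2))

/-! ### Planar distances -/

/-! Each number in the two lists is a planar distance: unfold the cube along some sequence of faces
and measure from one point to the image of the other. A symmetry of the cube (`frameMap`) puts the
first point `p` on `F1` and the second on `F2` or `F6`.

Lower bound: no face sequences of paths are classified. Instead `facePotential` puts the claimed
distance from `p` on every face. On one face it is a minimum of distances to fixed points of a
plane, hence 1-Lipschitz (`facePotential_sub_le_dist`). On common edges the formulas agree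
(`facePotential_eq`), and at `p` the value is zero. Such a function cannot grow faster than arc
length, so its value at the endpoint bounds the length of every surface path
(`ofReal_sub_le_eVariationOn_of_cover`, `facePotential_le_eVariationOn`).

Upper bound: an unfolded segment may leave its landscape and then is not a path on the cube. It is
cut where it leaves the face of the endpoint, and the rest is replaced by a surface path that is no
longer. For adjacent faces (`reachableWithin_adjacent_front_bottom`) the replacement is a direct
trail or a segment in `F1`. For opposite faces (`reachableWithin_opposite`) the cut lies on an edge,
where the adjacent case and edge agreement supply the path. As the bounds coincide, the infimum is
attained. -/

/-- The triangle inequality in the plane. The squared displacement `e` is left free because the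
callers measure it in coordinates that differ from these by a rigid motion, which `ring` can absorb.
-/
theorem sqrt_sq_add_sq_le_add (a b c d e : ℝ) (h : (a - c) ^ 2 + (b - d) ^ 2 = e) :
    √(a ^ 2 + b ^ 2) ≤ √(c ^ 2 + d ^ 2) + √e := by
  have key := norm_le_norm_add_norm_sub' (a + b * Complex.I) (c + d * Complex.I)
  have h2 : (a + b * Complex.I : ℂ) - (c + d * Complex.I) =
      ((a - c : ℝ) : ℂ) + ((b - d : ℝ) : ℂ) * Complex.I := by push_cast; ring
  rwa [h2, Complex.norm_add_mul_I, Complex.norm_add_mul_I, Complex.norm_add_mul_I, h] at key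

/-- Each trail is the distance from a fixed point to a rigid image of `(u, v)`, so it is 1-Lipschitz
in `(u, v)`; a minimum of 1-Lipschitz functions is again 1-Lipschitz. -/
theorem adjacentTrailMin_le_add (x y u v u' v' : ℝ) :
    adjacentTrailMin x y u v ≤ adjacentTrailMin x y u' v' + √((u - u') ^ 2 + (v - v') ^ 2) := by
  simp only [adjacentTrailMin, ← min_add_add_right]
  iterate 2 refine min_le_min (sqrt_sq_add_sq_le_add _ _ _ _ _ (by ring)) ?_
  exact sqrt_sq_add_sq_le_add _ _ _ _ _ (by ring)

theorem oppositeTrailMin_le_add (x y u v u' v' : ℝ) :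
    oppositeTrailMin x y u v ≤ oppositeTrailMin x y u' v' + √((u - u') ^ 2 + (v - v') ^ 2) := by
  simp only [oppositeTrailMin, ← min_add_add_right]
  iterate 11 refine min_le_min (sqrt_sq_add_sq_le_add _ _ _ _ _ (by ring)) ?_
  exact sqrt_sq_add_sq_le_add _ _ _ _ _ (by ring)

/-- A point on a segment splits its length. -/
theorem sqrt_eq_add_of_convex (u v a b t e f : ℝ) (h0 : 0 ≤ t) (h1 : t ≤ 1)
    (he : e = (1 - t) * u + t * a) (hf : f = (1 - t) * v + t * b) :
    √((u - a) ^ 2 + (v - b) ^ 2) =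
      √((u - e) ^ 2 + (v - f) ^ 2) + √((e - a) ^ 2 + (f - b) ^ 2) := by
  have e1 : (u - e) ^ 2 + (v - f) ^ 2 = t ^ 2 * ((u - a) ^ 2 + (v - b) ^ 2) := by
    rw [he, hf]; ring
  have e2 : (e - a) ^ 2 + (f - b) ^ 2 = (1 - t) ^ 2 * ((u - a) ^ 2 + (v - b) ^ 2) := by
    rw [he, hf]; ring
  rw [e1, e2, Real.sqrt_mul (sq_nonneg _), Real.sqrt_mul (sq_nonneg _), Real.sqrt_sq h0,
    Real.sqrt_sq (sub_nonneg.2 h1)]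
  ring

theorem exists_eq_zero_of_sign_change {m : ℝ → ℝ} (hm : Continuous m) (h0 : 0 ≤ m 0)
    (h1 : m 1 ≤ 0) : ∃ t : ℝ, 0 ≤ t ∧ t ≤ 1 ∧ m t = 0 := by
  obtain ⟨t, ht, h⟩ := intermediate_value_Icc' zero_le_one hm.continuousOn ⟨h1, h0⟩
  exact ⟨t, ht.1, ht.2, h⟩

/-- A segment leaving a quadrant crosses its boundary. -/
theorem exists_quadrant_crossing (u v a b : ℝ) (hu : 0 ≤ u) (hv : 0 ≤ v) (h : a ≤ 0 ∨ b ≤ 0) :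
    ∃ t : ℝ, 0 ≤ t ∧ t ≤ 1 ∧ 0 ≤ (1 - t) * u + t * a ∧ 0 ≤ (1 - t) * v + t * b ∧
      ((1 - t) * u + t * a = 0 ∨ (1 - t) * v + t * b = 0) := by
  obtain ⟨t, h0, h1, ht⟩ := exists_eq_zero_of_sign_change
    (m := fun t => min ((1 - t) * u + t * a) ((1 - t) * v + t * b)) (by fun_prop)
    (by simp [hu, hv]) (by simpa using h)
  refine ⟨t, h0, h1, ?_, ?_, ?_⟩
  · exact ht.ge.trans (min_le_left _ _)
  · exact ht.ge.trans (min_le_right _ _)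
  · exact (min_choice _ _).imp (fun h => h.symm.trans ht) (fun h => h.symm.trans ht)

/-- A segment leaving the unit square crosses its boundary. -/
theorem exists_square_crossing (u v a b : ℝ) (hu : u ∈ Set.Icc (0 : ℝ) 1)
    (hv : v ∈ Set.Icc (0 : ℝ) 1) (h : a ≤ 0 ∨ 1 ≤ a ∨ b ≤ 0 ∨ 1 ≤ b) :
    ∃ e f : ℝ, e ∈ Set.Icc (0 : ℝ) 1 ∧ f ∈ Set.Icc (0 : ℝ) 1 ∧
      (e = 0 ∨ e = 1 ∨ f = 0 ∨ f = 1) ∧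
      √((u - a) ^ 2 + (v - b) ^ 2) =
        √((u - e) ^ 2 + (v - f) ^ 2) + √((e - a) ^ 2 + (f - b) ^ 2) := by
  -- The least of the four slacks is nonnegative exactly on the square and zero exactly on its
  -- boundary, so a zero of it is a crossing.
  obtain ⟨t, h0, h1, ht⟩ := exists_eq_zero_of_sign_change
    (m := fun t => min (min ((1 - t) * u + t * a) (1 - ((1 - t) * u + t * a)))
      (min ((1 - t) * v + t * b) (1 - ((1 - t) * v + t * b)))) (by fun_prop)
    (by simp [hu.1, hu.2, hv.1, hv.2]) (by simpa [or_assoc] using h)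
  refine ⟨_, _, ?_, ?_, ?_, sqrt_eq_add_of_convex u v a b t _ _ h0 h1 rfl rfl⟩
  all_goals
    generalize (1 - t) * u + t * a = e at ht ⊢
    generalize (1 - t) * v + t * b = f at ht ⊢
    have h2 := ht.ge
    simp only [le_min_iff] at h2
  · exact ⟨by linarith, by linarith⟩
  · exact ⟨by linarith, by linarith⟩
  · have h3 := ht.le
    simp only [min_le_iff] at h3
    rcases h3 with (h3 | h3) | (h3 | h3)
    · exact Or.inl (by linarith)
    · exact Or.inr (Or.inl (by linarith))
    · exact Or.inr (Or.inr (Or.inl (by linarith)))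
    · exact Or.inr (Or.inr (Or.inr (by linarith)))

/-! ### The trail minima on the edges of the cube -/

/-- Agreement with the flat distance on the edge shared with the home face. The detours lose: their
squares exceed the direct one by `2 * (1 - t) * (x + y)` and `2 * t * (1 - x + y)`. -/
theorem adjacentTrailMin_zero_right (x y t : ℝ) (hx : x ∈ Set.Icc (0 : ℝ) 1)
    (hy : y ∈ Set.Icc (0 : ℝ) 1) (ht : t ∈ Set.Icc (0 : ℝ) 1) :
    adjacentTrailMin x y t 0 = √((x + t - 1) ^ 2 + y ^ 2) := by
  obtain ⟨hx0, hx1⟩ := hx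
  obtain ⟨hy0, hy1⟩ := hy
  obtain ⟨ht0, ht1⟩ := ht
  rw [adjacentTrailMin, add_zero, min_eq_left]
  refine le_min (Real.sqrt_le_sqrt ?_) (Real.sqrt_le_sqrt ?_)
  · nlinarith [mul_nonneg hx0 (sub_nonneg.2 ht1), mul_nonneg hy0 (sub_nonneg.2 ht1)]
  · nlinarith [mul_nonneg ht0 (sub_nonneg.2 hx1), mul_nonneg ht0 hy0]

/-- Agreement on an edge between two neighbours of the home face. The direct trail to either
neighbour is a detour trail to the other; the one trail left over on each side is dominated. -/
theorem adjacentTrailMin_side (x y s : ℝ) (hx : x ∈ Set.Icc (0 : ℝ) 1)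
    (hy : y ∈ Set.Icc (0 : ℝ) 1) (hs : s ∈ Set.Icc (0 : ℝ) 1) :
    adjacentTrailMin x y 0 s = adjacentTrailMin y (1 - x) 1 s := by
  obtain ⟨hx0, hx1⟩ := hx
  obtain ⟨hy0, hy1⟩ := hy
  obtain ⟨hs0, hs1⟩ := hs
  have e1 : (y + 1 - 1) ^ 2 + (1 - x + s) ^ 2 = (x - s - 1) ^ 2 + (y + 0) ^ 2 := by ring
  have e2 : (y + s) ^ 2 + (1 - x - 1 + 1) ^ 2 = (x + 0 - 1) ^ 2 + (y + s) ^ 2 := by ring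
  rw [adjacentTrailMin, adjacentTrailMin, e1, e2]
  apply le_antisymm
  · refine le_min ?_ (le_min ?_ ?_)
    · exact (min_le_right _ _).trans (min_le_right _ _)
    · exact min_le_left _ _
    · refine ((min_le_right _ _).trans (min_le_right _ _)).trans (Real.sqrt_le_sqrt ?_)
      nlinarith [mul_nonneg hs0 (sub_nonneg.2 hx1), mul_nonneg hs0 (sub_nonneg.2 hy1)]
  · refine le_min ?_ (le_min ?_ ?_)
    · exact (min_le_right _ _).trans (min_le_left _ _)
    · refine ((min_le_right _ _).trans (min_le_left _ _)).trans (Real.sqrt_le_sqrt ?_)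
      nlinarith [mul_nonneg hs0 hx0, mul_nonneg hy0 (sub_nonneg.2 hs1)]
    · exact min_le_left _ _

/-- Agreement on an edge of the opposite face. Three of the twelve trails (the first, tenth and
eighth) become the three adjacent trails, and each of the others is at least one of these. -/
theorem oppositeTrailMin_zero_right (x y t : ℝ) (hx : x ∈ Set.Icc (0 : ℝ) 1)
    (hy : y ∈ Set.Icc (0 : ℝ) 1) (ht : t ∈ Set.Icc (0 : ℝ) 1) :
    oppositeTrailMin x y t 0 = adjacentTrailMin x y t 1 := by
  obtain ⟨hx0, hx1⟩ := hx
  obtain ⟨hy0, hy1⟩ := hy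
  obtain ⟨ht0, ht1⟩ := ht
  have hx1' := sub_nonneg.2 hx1
  have hy1' := sub_nonneg.2 hy1
  have ht1' := sub_nonneg.2 ht1
  -- The differences of squares below are nonnegative combinations of such products and of the
  -- bounds, so with these at hand `linarith` suffices.
  have hxy := mul_nonneg hx0 hy0
  have hxy' := mul_nonneg hx0 hy1'
  have hxt := mul_nonneg hx0 ht0
  have hxt' := mul_nonneg hx0 ht1'
  have hyt := mul_nonneg hy0 ht0
  have hyt' := mul_nonneg hy0 ht1'
  have hx'y := mul_nonneg hx1' hy0
  have hx'y' := mul_nonneg hx1' hy1'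
  have hx't := mul_nonneg hx1' ht0
  have hx't' := mul_nonneg hx1' ht1'
  have hy't := mul_nonneg hy1' ht0
  have hy't' := mul_nonneg hy1' ht1'
  have a1 : adjacentTrailMin x y t 1 ≤ √((x + t - 1) ^ 2 + (y + 1) ^ 2) := min_le_left _ _
  have a2 : adjacentTrailMin x y t 1 ≤ √((x + 1) ^ 2 + (y - t + 1) ^ 2) :=
    (min_le_right _ _).trans (min_le_left _ _)
  have a3 : adjacentTrailMin x y t 1 ≤ √((x - 1 - 1) ^ 2 + (y + t) ^ 2) :=
    (min_le_right _ _).trans (min_le_right _ _)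
  apply le_antisymm
  · rw [adjacentTrailMin, oppositeTrailMin]
    refine le_min ?_ (le_min ?_ ?_)
    · exact (min_le_left _ _).trans (by simp)
    · have e : (x + 1) ^ 2 + (y - t + 1) ^ 2 = (y - t + 1) ^ 2 + (x + 0 + 1) ^ 2 := by ring
      rw [e]
      simp
    · have e : (x - 1 - 1) ^ 2 + (y + t) ^ 2 = (y + t) ^ 2 + (x - 0 - 2) ^ 2 := by ring
      rw [e]
      simp
  · rw [oppositeTrailMin]
    refine le_min ?_ <| le_min ?_ <| le_min ?_ <| le_min ?_ <| le_min ?_ <| le_min ?_ <|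
      le_min ?_ <| le_min ?_ <| le_min ?_ <| le_min ?_ <| le_min ?_ ?_
    · exact a1.trans (Real.sqrt_le_sqrt (by linarith))
    · exact a2.trans (Real.sqrt_le_sqrt (by linarith))
    · exact a3.trans (Real.sqrt_le_sqrt (by linarith))
    · exact a1.trans (Real.sqrt_le_sqrt (by linarith))
    · exact a1.trans (Real.sqrt_le_sqrt (by linarith))
    · exact a2.trans (Real.sqrt_le_sqrt (by linarith))
    · exact a3.trans (Real.sqrt_le_sqrt (by linarith))
    · exact a3.trans (Real.sqrt_le_sqrt (by linarith))
    · exact a1.trans (Real.sqrt_le_sqrt (by linarith))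
    · exact a2.trans (Real.sqrt_le_sqrt (by linarith))
    · exact a2.trans (Real.sqrt_le_sqrt (by linarith))
    · exact a3.trans (Real.sqrt_le_sqrt (by linarith))

/-- A quarter turn does not change the minimum over the twelve landscapes. -/
theorem oppositeTrailMin_rotate (x y u v : ℝ) :
    oppositeTrailMin x y u v = oppositeTrailMin y (1 - x) (1 - v) u := by
  have e1 : (y + (1 - v) - 1) ^ 2 + (1 - x + u + 1) ^ 2 =
    (y - v) ^ 2 + (x - u - 2) ^ 2 := by ring
  have e2 : (1 - x - u) ^ 2 + (y - (1 - v) + 2) ^ 2 =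
    (x + u - 1) ^ 2 + (y + v + 1) ^ 2 := by ring
  have e3 : (1 - x - u) ^ 2 + (y - (1 - v) - 2) ^ 2 =
    (x + u - 1) ^ 2 + (y + v - 3) ^ 2 := by ring
  have e4 : (y + (1 - v) - 1) ^ 2 + (1 - x + u - 3) ^ 2 =
    (y - v) ^ 2 + (x - u + 2) ^ 2 := by ring
  have e5 : (y + u) ^ 2 + (1 - x - (1 - v) + 2) ^ 2 =
    (y + u) ^ 2 + (x - v - 2) ^ 2 := by ring
  have e6 : (1 - x + (1 - v) - 2) ^ 2 + (y - u + 2) ^ 2 =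
    (x + v) ^ 2 + (y - u + 2) ^ 2 := by ring
  have e7 : (y + u - 2) ^ 2 + (1 - x - (1 - v) - 2) ^ 2 =
    (y + u - 2) ^ 2 + (x - v + 2) ^ 2 := by ring
  have e8 : (1 - x + (1 - v)) ^ 2 + (y - u - 2) ^ 2 =
    (x + v - 2) ^ 2 + (y - u - 2) ^ 2 := by ring
  have e9 : (y - u - 1) ^ 2 + (1 - x + (1 - v) + 1) ^ 2 =
    (y - u - 1) ^ 2 + (x + v - 3) ^ 2 := by ring
  have e10 : (1 - x - (1 - v) + 1) ^ 2 + (y + u + 1) ^ 2 =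
    (x - v - 1) ^ 2 + (y + u + 1) ^ 2 := by ring
  have e11 : (y - u + 1) ^ 2 + (1 - x + (1 - v) - 3) ^ 2 =
    (y - u + 1) ^ 2 + (x + v + 1) ^ 2 := by ring
  have e12 : (1 - x - (1 - v) - 1) ^ 2 + (y + u - 3) ^ 2 =
    (x - v + 1) ^ 2 + (y + u - 3) ^ 2 := by ring
  rw [oppositeTrailMin, oppositeTrailMin, e1, e2, e3, e4, e5, e6, e7, e8, e9, e10, e11, e12]
  ac_rfl

/-! ### Lengths of paths -/

section Paths

variable {E : Type*} [PseudoEMetricSpace E]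

/-- There is a path from `p` to `q` in `S` of length at most `r`. -/
def ReachableWithin (S : Set E) (p q : E) (r : ℝ≥0∞) : Prop :=
  ∃ γ : Path p q, (∀ t, γ t ∈ S) ∧ eVariationOn γ Set.univ ≤ r

theorem ReachableWithin.mono {S : Set E} {p q : E} {r r' : ℝ≥0∞} (h : ReachableWithin S p q r)
    (hr : r ≤ r') : ReachableWithin S p q r' :=
  let ⟨γ, hγ, hl⟩ := h
  ⟨γ, hγ, hl.trans hr⟩

/-- On each half of the interval the concatenation is one of the two paths after a monotone change
of parameter, which cannot increase variation. `Set.projIcc` makes that change of parameter total.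
-/
theorem eVariationOn_trans_le {p q r : E} (γ : Path p q) (δ : Path q r) :
    eVariationOn (γ.trans δ) Set.univ ≤ eVariationOn γ Set.univ + eVariationOn δ Set.univ := by
  have hhalf : (1 / 2 : ℝ) ∈ Set.Icc (0 : ℝ) 1 := ⟨by norm_num, by norm_num⟩
  set c : unitInterval := ⟨1 / 2, hhalf⟩
  have hu : (Set.univ : Set unitInterval) = Set.Iic c ∪ Set.Ici c := Set.Iic_union_Ici.symm
  have h1 : eVariationOn (γ.trans δ) (Set.Iic c) ≤ eVariationOn γ Set.univ := by
    have : Set.EqOn (γ.trans δ) (γ ∘ fun t => Set.projIcc 0 1 zero_le_one (2 * (t : ℝ)))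
        (Set.Iic c) := by
      intro t ht
      have ht' : (t : ℝ) ≤ 1 / 2 := ht
      simp only [Path.trans_apply, Function.comp, ht', dif_pos]
      congr 1
      rw [Set.projIcc_of_mem]
    rw [eVariationOn.congr this]
    refine eVariationOn.comp_le_of_monotoneOn _ _ ?_ (Set.mapsTo_univ _ _)
    intro a _ b _ hab
    refine Set.monotone_projIcc _ ?_
    have : (a : ℝ) ≤ b := hab
    linarith
  have h2 : eVariationOn (γ.trans δ) (Set.Ici c) ≤ eVariationOn δ Set.univ := by
    have : Set.EqOn (γ.trans δ) (δ ∘ fun t => Set.projIcc 0 1 zero_le_one (2 * (t : ℝ) - 1))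
        (Set.Ici c) := by
      intro t ht
      have ht' : 1 / 2 ≤ (t : ℝ) := ht
      rcases ht'.eq_or_lt with h | h
      · have h3 : (t : ℝ) = 1 / 2 := h.symm
        simp [Path.trans_apply, Function.comp, h3]
      · simp only [Path.trans_apply, Function.comp, not_le.2 h, dif_neg, not_false_eq_true]
        congr 1
        rw [Set.projIcc_of_mem]
    rw [eVariationOn.congr this]
    refine eVariationOn.comp_le_of_monotoneOn _ _ ?_ (Set.mapsTo_univ _ _)
    intro a _ b _ hab
    refine Set.monotone_projIcc _ ?_
    have : (a : ℝ) ≤ b := hab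
    linarith
  calc eVariationOn (γ.trans δ) Set.univ
      = eVariationOn (γ.trans δ) (Set.Iic c) + eVariationOn (γ.trans δ) (Set.Ici c) := by
        rw [hu, eVariationOn.union _ isGreatest_Iic isLeast_Ici]
    _ ≤ _ := add_le_add h1 h2

theorem ReachableWithin.trans {S : Set E} {p q r : E} {a b : ℝ≥0∞}
    (h : ReachableWithin S p q a) (h' : ReachableWithin S q r b) :
    ReachableWithin S p r (a + b) := by
  obtain ⟨γ, hγ, hl⟩ := h
  obtain ⟨δ, hδ, hl'⟩ := h'
  refine ⟨γ.trans δ, fun t => ?_, (eVariationOn_trans_le γ δ).trans (add_le_add hl hl')⟩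
  rw [Path.trans_apply]
  split_ifs
  exacts [hγ _, hδ _]

theorem ReachableWithin.map {F : Type*} [PseudoEMetricSpace F] {S : Set E} {T : Set F}
    {p q : E} {r : ℝ≥0∞} (h : ReachableWithin S p q r) {f : E → F} (hf : LipschitzWith 1 f)
    (hS : Set.MapsTo f S T) : ReachableWithin T (f p) (f q) r := by
  obtain ⟨γ, hγ, hl⟩ := h
  refine ⟨γ.map hf.continuous, fun t => hS (hγ t), le_trans ?_ hl⟩
  have := hf.lipschitzOnWith (s := Set.univ) |>.comp_eVariationOn_le (Set.mapsTo_univ γ Set.univ)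
  simpa using this

/-- The affine parametrization is Lipschitz with constant the distance of the endpoints, and the
parameter interval has variation at most one. -/
theorem reachableWithin_segment {V : Type*} [NormedAddCommGroup V] [NormedSpace ℝ V] {S : Set V}
    {p q : V} (h : segment ℝ p q ⊆ S) : ReachableWithin S p q (edist p q) := by
  let f : unitInterval → V := fun t => AffineMap.lineMap p q (t : ℝ)
  have hf : LipschitzWith (nndist p q) f :=
    ((lipschitzWith_lineMap p q).comp (LipschitzWith.subtype_val _)).weaken (by simp)
  refine ⟨⟨⟨f, hf.continuous⟩, by simp [f], by simp [f]⟩, fun t => h ?_, ?_⟩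
  · rw [segment_eq_image_lineMap]
    exact ⟨t, t.2, rfl⟩
  · have h1 := (hf.lipschitzOnWith (s := Set.univ)).comp_eVariationOn_le
      (Set.mapsTo_univ (id : unitInterval → unitInterval) Set.univ)
    have h2 : eVariationOn (id : unitInterval → unitInterval) Set.univ ≤ 1 := by
      have h3 : eVariationOn (id : unitInterval → unitInterval) Set.univ =
          eVariationOn (Subtype.val : unitInterval → ℝ) Set.univ := rfl
      rw [h3]
      have h4 : MonotoneOn (Subtype.val : unitInterval → ℝ) Set.univ :=
        (Subtype.mono_coe _).monotoneOn _
      have h5 := h4.eVariationOn_eq (Set.mem_univ 0) (Set.mem_univ 1)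
      have h6 : Set.univ ∩ Set.Icc (0 : unitInterval) 1 = Set.univ :=
        Set.eq_univ_of_forall fun t => ⟨trivial, unitInterval.nonneg', unitInterval.le_one'⟩
      rw [h6] at h5
      simp [h5]
    calc eVariationOn f Set.univ ≤ nndist p q * eVariationOn id Set.univ := h1
      _ ≤ nndist p q * 1 := by gcongr
      _ = edist p q := by rw [mul_one, edist_nndist]

/-- If the parameter interval is covered by finitely many closed sets on each of which `g` grows
no faster than `γ` moves, then the total growth of `g` is at most the length of `γ`. -/
theorem ofReal_sub_le_eVariationOn_of_cover {ι : Type*} [DecidableEq ι]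
    (γ : unitInterval → E) (g : unitInterval → ℝ) (A : ι → Set unitInterval)
    (hA : ∀ i, IsClosed (A i))
    (hg : ∀ i, ∀ s ∈ A i, ∀ t ∈ A i, ENNReal.ofReal (g t - g s) ≤ edist (γ s) (γ t))
    (S : Finset ι) (a : unitInterval) (hS : ∀ t, a ≤ t → ∃ i ∈ S, t ∈ A i) :
    ENNReal.ofReal (g 1 - g a) ≤ eVariationOn γ (Set.Icc a 1) := by
  induction S using Finset.strongInduction generalizing a with
  | H S ih =>
    obtain ⟨i, hi, hai⟩ := hS a le_rfl
    -- Jump to the last time spent in `A i`. After `b` this set is never met again, so the induction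
    -- continues with one set fewer; `g` need not be continuous.
    obtain ⟨b, hb, hmax⟩ := (hA i).isCompact.exists_isGreatest ⟨a, hai⟩
    have hab : a ≤ b := hmax hai
    have hb1 : b ≤ 1 := unitInterval.le_one'
    have hfirst : ENNReal.ofReal (g b - g a) ≤ eVariationOn γ (Set.Icc a b) :=
      (hg i a hai b hb).trans
        (eVariationOn.edist_le γ ⟨le_rfl, hab⟩ ⟨hab, le_rfl⟩)
    rcases hb1.eq_or_lt with rfl | hlt
    · exact hfirst
    · have hcov : ∀ t, b < t → ∃ j ∈ S.erase i, t ∈ A j := fun t ht => by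
        obtain ⟨j, hj, htj⟩ := hS t (hab.trans ht.le)
        refine ⟨j, Finset.mem_erase.2 ⟨?_, hj⟩, htj⟩
        rintro rfl
        exact (hmax htj).not_gt ht
      have hcl : IsClosed (⋃ j ∈ S.erase i, A j) :=
        (S.erase i).finite_toSet.isClosed_biUnion fun j _ => hA j
      have hsub : Set.Ioi b ⊆ ⋃ j ∈ S.erase i, A j := fun t ht => by
        simpa using hcov t ht
      -- The remaining sets cover only the times after `b`; being closed and finitely many, they
      -- also cover `b` itself.
      have hbmem : b ∈ closure (Set.Ioi b) := by
        rw [closure_Ioi' (a := b) ⟨1, hlt⟩]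
        exact Set.self_mem_Ici
      have hb' := hcl.closure_subset_iff.2 hsub hbmem
      have hrest := ih (S.erase i) (Finset.erase_ssubset hi) b fun t ht => by
        rcases ht.eq_or_lt with rfl | h
        · simpa using hb'
        · exact hcov t h
      calc ENNReal.ofReal (g 1 - g a) = ENNReal.ofReal ((g b - g a) + (g 1 - g b)) := by
            congr 1; ring
        _ ≤ ENNReal.ofReal (g b - g a) + ENNReal.ofReal (g 1 - g b) := ENNReal.ofReal_add_le
        _ ≤ eVariationOn γ (Set.Icc a b) + eVariationOn γ (Set.Icc b 1) :=
            add_le_add hfirst hrest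
        _ = eVariationOn γ (Set.Icc a 1) := by
            rw [← eVariationOn.union γ (isGreatest_Icc hab) (isLeast_Icc hb1),
              Set.Icc_union_Icc_eq_Icc hab hb1]

end Paths

/-! ### Coordinates on the cube -/

namespace CubeFace

theorem mem_carrier_F1 {p : Space3} :
    p ∈ F1.carrier ↔ (∀ i, p i ∈ Set.Icc (0 : ℝ) 1) ∧ p 2 = 1 := by
  simp only [carrier, normal, fromCentre, Set.mem_ofPred_eq, dotProduct, Fin.sum_univ_three,
    Matrix.cons_val, zero_mul, one_mul, zero_add]
  exact and_congr_right fun _ => ⟨fun h => by linarith, fun h => by linarith⟩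

theorem mem_carrier_F2 {p : Space3} :
    p ∈ F2.carrier ↔ (∀ i, p i ∈ Set.Icc (0 : ℝ) 1) ∧ p 1 = 0 := by
  simp only [carrier, normal, fromCentre, Set.mem_ofPred_eq, dotProduct, Fin.sum_univ_three,
    Matrix.cons_val, zero_mul, zero_add]
  exact and_congr_right fun _ => ⟨fun h => by linarith, fun h => by linarith⟩

theorem mem_carrier_F3 {p : Space3} :
    p ∈ F3.carrier ↔ (∀ i, p i ∈ Set.Icc (0 : ℝ) 1) ∧ p 0 = 0 := by
  simp only [carrier, normal, fromCentre, Set.mem_ofPred_eq, dotProduct, Fin.sum_univ_three,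
    Matrix.cons_val, zero_mul]
  exact and_congr_right fun _ => ⟨fun h => by linarith, fun h => by linarith⟩

theorem mem_carrier_F4 {p : Space3} :
    p ∈ F4.carrier ↔ (∀ i, p i ∈ Set.Icc (0 : ℝ) 1) ∧ p 0 = 1 := by
  simp only [carrier, normal, fromCentre, Set.mem_ofPred_eq, dotProduct, Fin.sum_univ_three,
    Matrix.cons_val, zero_mul, one_mul]
  exact and_congr_right fun _ => ⟨fun h => by linarith, fun h => by linarith⟩

theorem mem_carrier_F5 {p : Space3} :
    p ∈ F5.carrier ↔ (∀ i, p i ∈ Set.Icc (0 : ℝ) 1) ∧ p 1 = 1 := by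
  simp only [carrier, normal, fromCentre, Set.mem_ofPred_eq, dotProduct, Fin.sum_univ_three,
    Matrix.cons_val, zero_mul, one_mul, zero_add]
  exact and_congr_right fun _ => ⟨fun h => by linarith, fun h => by linarith⟩

theorem mem_carrier_F6 {p : Space3} :
    p ∈ F6.carrier ↔ (∀ i, p i ∈ Set.Icc (0 : ℝ) 1) ∧ p 2 = 0 := by
  simp only [carrier, normal, fromCentre, Set.mem_ofPred_eq, dotProduct, Fin.sum_univ_three,
    Matrix.cons_val, zero_mul, zero_add]
  exact and_congr_right fun _ => ⟨fun h => by linarith, fun h => by linarith⟩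

theorem isClosed_carrier (n : CubeFace) : IsClosed n.carrier := by
  have h0 : IsClosed {p : Space3 | ∀ i, p i ∈ Set.Icc (0 : ℝ) 1} := by
    simp only [Set.ofPred_forall]
    exact isClosed_iInter fun i => isClosed_Icc.preimage (by fun_prop)
  refine h0.inter (isClosed_eq ?_ continuous_const)
  simp only [dotProduct, fromCentre, Fin.sum_univ_three]
  fun_prop

theorem convex_carrier (n : CubeFace) : Convex ℝ n.carrier := by
  rintro p ⟨hp, hp'⟩ q ⟨hq, hq'⟩ a b ha hb hab
  refine ⟨fun i => ?_, ?_⟩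
  · have := (convex_Icc (0 : ℝ) 1) (hp i) (hq i) ha hb hab
    simpa using this
  · simp only [dotProduct, fromCentre, Fin.sum_univ_three, PiLp.add_apply, PiLp.smul_apply,
      smul_eq_mul] at hp' hq' ⊢
    obtain rfl : b = 1 - a := by linarith
    linear_combination a * hp' + (1 - a) * hq'

theorem carrier_subset_cubeSurface (n : CubeFace) : n.carrier ⊆ cubeSurface :=
  Set.subset_iUnion carrier n

end CubeFace

open CubeFace

theorem dist_space3 (p q : Space3) :
    dist p q = √((p 0 - q 0) ^ 2 + (p 1 - q 1) ^ 2 + (p 2 - q 2) ^ 2) := by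
  rw [EuclideanSpace.dist_eq, Fin.sum_univ_three]
  simp only [Real.dist_eq, sq_abs]

theorem reachableWithin_face {n : CubeFace} {p q : Space3} (hp : p ∈ n.carrier)
    (hq : q ∈ n.carrier) : ReachableWithin cubeSurface p q (ENNReal.ofReal (dist p q)) := by
  rw [← edist_dist]
  exact reachableWithin_segment
    ((n.convex_carrier.segment_subset hp hq).trans n.carrier_subset_cubeSurface)

theorem mem_cubeSurface {p : Space3} :
    p ∈ cubeSurface ↔ (∀ i, p i ∈ Set.Icc (0 : ℝ) 1) ∧
      (p 0 = 0 ∨ p 0 = 1 ∨ p 1 = 0 ∨ p 1 = 1 ∨ p 2 = 0 ∨ p 2 = 1) := by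
  rw [cubeSurface, Set.mem_iUnion]
  constructor
  · rintro ⟨n, hn⟩
    cases n <;> simp only [mem_carrier_F1, mem_carrier_F2, mem_carrier_F3, mem_carrier_F4,
      mem_carrier_F5, mem_carrier_F6] at hn <;> exact ⟨hn.1, by simp [hn.2]⟩
  · rintro ⟨h, h' | h' | h' | h' | h' | h'⟩
    · exact ⟨F3, mem_carrier_F3.2 ⟨h, h'⟩⟩
    · exact ⟨F4, mem_carrier_F4.2 ⟨h, h'⟩⟩
    · exact ⟨F2, mem_carrier_F2.2 ⟨h, h'⟩⟩
    · exact ⟨F5, mem_carrier_F5.2 ⟨h, h'⟩⟩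
    · exact ⟨F6, mem_carrier_F6.2 ⟨h, h'⟩⟩
    · exact ⟨F1, mem_carrier_F1.2 ⟨h, h'⟩⟩

/-! ### Moving a pair of adjacent faces to the front and the bottom -/

/-- The isometry of the cube that takes the face `n` to `F1` and the adjacent face `k` to `F2`. -/
noncomputable def frameMap (n k : CubeFace) (p : Space3) : Space3 :=
  !₂[1 / 2 + (n.normal ⨯₃ k.normal) ⬝ᵥ fromCentre p, 1 / 2 - k.normal ⬝ᵥ fromCentre p,
    1 / 2 + n.normal ⬝ᵥ fromCentre p]

theorem frameMap_apply (n k : CubeFace) (p : Space3) :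
    frameMap n k p 0 = 1 / 2 + (n.normal ⨯₃ k.normal) ⬝ᵥ fromCentre p ∧
    frameMap n k p 1 = 1 / 2 - k.normal ⬝ᵥ fromCentre p ∧
    frameMap n k p 2 = 1 / 2 + n.normal ⬝ᵥ fromCentre p := ⟨rfl, rfl, rfl⟩

/-- The map permutes the coordinates and replaces some of them by their complements to `1`. -/
def IsSignedPermutation (f : Space3 → Space3) : Prop :=
  ∃ σ : Equiv.Perm (Fin 3), ∀ i, (∀ p, f p i = p (σ i)) ∨ (∀ p, f p i = 1 - p (σ i))

theorem IsSignedPermutation.isometry {f : Space3 → Space3} (hf : IsSignedPermutation f) :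
    Isometry f := by
  obtain ⟨σ, hσ⟩ := hf
  refine Isometry.of_dist_eq fun p q => ?_
  rw [EuclideanSpace.dist_eq, EuclideanSpace.dist_eq,
    ← Equiv.sum_comp σ fun i => dist (p i) (q i) ^ 2]
  congr 1
  refine Finset.sum_congr rfl fun i _ => ?_
  rcases hσ i with h | h
  · rw [h, h]
  · rw [h, h, dist_sub_left]

theorem IsSignedPermutation.mapsTo {f : Space3 → Space3} (hf : IsSignedPermutation f) :
    Set.MapsTo f cubeSurface cubeSurface := by
  have key : ∀ p : Space3, p ∈ cubeSurface ↔
      (∀ i, p i ∈ Set.Icc (0 : ℝ) 1) ∧ ∃ i, p i = 0 ∨ p i = 1 := fun p => by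
    rw [mem_cubeSurface, Fin.exists_fin_succ, Fin.exists_fin_succ, Fin.exists_fin_succ]
    simp [or_assoc]
  obtain ⟨σ, hσ⟩ := hf
  intro p hp
  rw [key] at hp ⊢
  refine ⟨fun i => ?_, ?_⟩
  · have := hp.1 (σ i)
    rcases hσ i with h | h <;> rw [h]
    · exact this
    · exact ⟨by linarith [this.2], by linarith [this.1]⟩
  · obtain ⟨j, hj⟩ := hp.2
    refine ⟨σ.symm j, ?_⟩
    rcases hσ (σ.symm j) with h | h <;> rw [h, Equiv.apply_symm_apply]
    · exact hj
    · rcases hj with hj | hj <;> simp [hj]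

/-- Needed to carry a path built in the standard position back to the original faces. -/
theorem IsSignedPermutation.exists_leftInverse {f : Space3 → Space3}
    (hf : IsSignedPermutation f) : ∃ g, IsSignedPermutation g ∧ ∀ p, g (f p) = p := by
  classical
  obtain ⟨σ, hσ⟩ := hf
  refine ⟨fun p => WithLp.toLp 2 fun j => if ∀ q, f q (σ.symm j) = q (σ (σ.symm j)) then
    p (σ.symm j) else 1 - p (σ.symm j), ⟨σ.symm, fun i => ?_⟩, fun p => ?_⟩
  · by_cases h : ∀ q, f q (σ.symm i) = q (σ (σ.symm i))
    · exact Or.inl fun p => if_pos h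
    · exact Or.inr fun p => if_neg h
  · ext j
    by_cases h : ∀ q, f q (σ.symm j) = q (σ (σ.symm j))
    · exact (if_pos h).trans (by rw [h, Equiv.apply_symm_apply])
    · refine (if_neg h).trans ?_
      rw [(hσ _).resolve_left h, Equiv.apply_symm_apply, sub_sub_cancel]

theorem reachableWithin_of_isSignedPermutation {f : Space3 → Space3}
    (hf : IsSignedPermutation f) {p q : Space3} {r : ℝ≥0∞}
    (h : ReachableWithin cubeSurface (f p) (f q) r) : ReachableWithin cubeSurface p q r := by
  obtain ⟨g, hg, hgf⟩ := hf.exists_leftInverse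
  simpa only [hgf] using h.map hg.isometry.lipschitz hg.mapsTo

/-- The coordinate axis orthogonal to a face. -/
def CubeFace.axis : CubeFace → Fin 3
  | F1 => 2
  | F2 => 1
  | F3 => 0
  | F4 => 0
  | F5 => 1
  | F6 => 2

theorem isSignedPermutation_frameMap {n k : CubeFace} (h : Adjacent n k) :
    IsSignedPermutation (frameMap n k) := by
  obtain ⟨h1, h2⟩ := h
  -- The three axes sum to zero in `Fin 3`, so the axis of the cross product is minus the sum of the
  -- other two.
  have hb : Function.Bijective ![-(n.axis + k.axis), k.axis, n.axis] := by
    cases n <;> cases k <;> first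
      | exact absurd rfl h1
      | exact absurd rfl h2
      | decide
  refine ⟨Equiv.ofBijective _ hb, fun i => ?_⟩
  rw [Equiv.ofBijective_apply]
  have h3 : (-1 : Fin 3) = 2 := rfl
  have h4 : (-2 : Fin 3) = 1 := rfl
  cases n <;> cases k <;> first
    | exact absurd rfl h1
    | exact absurd rfl h2
    | fin_cases i <;> first
      | (left
         intro p
         simp [frameMap, normal, fromCentre, cross_apply, dotProduct, Fin.sum_univ_three, axis,
           h3, h4]
         done)
      | (right
         intro p
         simp [frameMap, normal, fromCentre, cross_apply, dotProduct, Fin.sum_univ_three, axis,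
           h3, h4]
         try ring1)

theorem frameMap_mem_Icc {n k : CubeFace} (h : Adjacent n k) {p : Space3}
    (hp : ∀ i, p i ∈ Set.Icc (0 : ℝ) 1) (i : Fin 3) : frameMap n k p i ∈ Set.Icc (0 : ℝ) 1 := by
  obtain ⟨σ, hσ⟩ := isSignedPermutation_frameMap h
  rcases hσ i with h | h <;> rw [h]
  · exact hp _
  · exact ⟨sub_nonneg.2 (hp _).2, sub_le_self _ (hp _).1⟩

theorem CubeFace.Represents.frameMap_home {n k : CubeFace} {p : Space3} {x y : ℝ}
    (h : Represents p n k x y) :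
    frameMap n k p ∈ F1.carrier ∧ frameMap n k p 0 = x ∧ frameMap n k p 1 = y := by
  obtain ⟨ha, ⟨hp, hp'⟩, rfl, rfl⟩ := h
  refine ⟨mem_carrier_F1.2 ⟨frameMap_mem_Icc ha hp, ?_⟩, rfl, rfl⟩
  rw [(frameMap_apply n k p).2.2, hp']
  norm_num

theorem CubeFace.Represents.frameMap_neighbour {n k : CubeFace} {p : Space3} {x y : ℝ}
    (ha : Adjacent n k) (h : Represents p k n x y) :
    frameMap n k p ∈ F2.carrier ∧ 1 - frameMap n k p 0 = x ∧ 1 - frameMap n k p 2 = y := by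
  obtain ⟨-, ⟨hp, hp'⟩, rfl, rfl⟩ := h
  refine ⟨mem_carrier_F2.2 ⟨frameMap_mem_Icc ha hp, ?_⟩, ?_, ?_⟩
  · rw [(frameMap_apply n k p).2.1, hp', sub_self]
  · rw [(frameMap_apply n k p).1, ← cross_anticomm k.normal n.normal, neg_dotProduct]
    ring
  · rw [(frameMap_apply n k p).2.2]
    ring

theorem CubeFace.normal_eq_neg {n m : CubeFace} (h : n.label + m.label = 7) :
    n.normal = -m.normal := by
  cases n <;> cases m <;> simp [label, normal] at h ⊢

/-- Passing to the opposite face negates the normal and with it the cross product, which reverses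
the first coordinate; the second depends on `k` alone. -/
theorem CubeFace.Represents.frameMap_opposite {n m k : CubeFace} {p : Space3} {x y : ℝ}
    (ha : Adjacent n k) (hm : n.label + m.label = 7) (h : Represents p m k x y) :
    frameMap n k p ∈ F6.carrier ∧ 1 - frameMap n k p 0 = x ∧ frameMap n k p 1 = y := by
  obtain ⟨-, ⟨hp, hp'⟩, rfl, rfl⟩ := h
  refine ⟨mem_carrier_F6.2 ⟨frameMap_mem_Icc ha hp, ?_⟩, ?_, rfl⟩
  · rw [(frameMap_apply n k p).2.2, normal_eq_neg hm, neg_dotProduct, hp', add_neg_cancel]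
  · rw [(frameMap_apply n k p).1, normal_eq_neg hm, LinearMap.map_neg, LinearMap.neg_apply,
      neg_dotProduct]
    ring

/-! ### Lower bound -/

/-- The surface distance, face by face, from the point `(x, y, 1)` of the front face. -/
noncomputable def facePotential (x y : ℝ) : CubeFace → Space3 → ℝ
  | F1, q => √((x - q 0) ^ 2 + (y - q 1) ^ 2)
  | F2, q => adjacentTrailMin x y (1 - q 0) (1 - q 2)
  | F3, q => adjacentTrailMin (1 - y) x (q 1) (1 - q 2)
  | F4, q => adjacentTrailMin y (1 - x) (1 - q 1) (1 - q 2)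
  | F5, q => adjacentTrailMin (1 - x) (1 - y) (q 0) (1 - q 2)
  | F6, q => oppositeTrailMin x y (1 - q 0) (q 1)

/-- On a face one space coordinate is constant, so the distance in space is the planar one and the
Lipschitz bounds for the trail minima apply. -/
theorem facePotential_sub_le_dist (x y : ℝ) {n : CubeFace} {p q : Space3} (hp : p ∈ n.carrier)
    (hq : q ∈ n.carrier) : facePotential x y n q - facePotential x y n p ≤ dist p q := by
  rw [sub_le_iff_le_add', dist_space3]
  cases n
  · rw [mem_carrier_F1] at hp hq
    have e : (p 0 - q 0) ^ 2 + (p 1 - q 1) ^ 2 + (p 2 - q 2) ^ 2 =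
        ((x - q 0) - (x - p 0)) ^ 2 + ((y - q 1) - (y - p 1)) ^ 2 := by
      rw [hp.2, hq.2]; ring
    rw [e]
    exact sqrt_sq_add_sq_le_add _ _ _ _ _ rfl
  · rw [mem_carrier_F2] at hp hq
    have e : (p 0 - q 0) ^ 2 + (p 1 - q 1) ^ 2 + (p 2 - q 2) ^ 2 =
        ((1 - q 0) - (1 - p 0)) ^ 2 + ((1 - q 2) - (1 - p 2)) ^ 2 := by
      rw [hp.2, hq.2]; ring
    rw [e]
    exact adjacentTrailMin_le_add _ _ _ _ _ _
  · rw [mem_carrier_F3] at hp hq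
    have e : (p 0 - q 0) ^ 2 + (p 1 - q 1) ^ 2 + (p 2 - q 2) ^ 2 =
        (q 1 - p 1) ^ 2 + ((1 - q 2) - (1 - p 2)) ^ 2 := by
      rw [hp.2, hq.2]; ring
    rw [e]
    exact adjacentTrailMin_le_add _ _ _ _ _ _
  · rw [mem_carrier_F4] at hp hq
    have e : (p 0 - q 0) ^ 2 + (p 1 - q 1) ^ 2 + (p 2 - q 2) ^ 2 =
        ((1 - q 1) - (1 - p 1)) ^ 2 + ((1 - q 2) - (1 - p 2)) ^ 2 := by
      rw [hp.2, hq.2]; ring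
    rw [e]
    exact adjacentTrailMin_le_add _ _ _ _ _ _
  · rw [mem_carrier_F5] at hp hq
    have e : (p 0 - q 0) ^ 2 + (p 1 - q 1) ^ 2 + (p 2 - q 2) ^ 2 =
        (q 0 - p 0) ^ 2 + ((1 - q 2) - (1 - p 2)) ^ 2 := by
      rw [hp.2, hq.2]; ring
    rw [e]
    exact adjacentTrailMin_le_add _ _ _ _ _ _
  · rw [mem_carrier_F6] at hp hq
    have e : (p 0 - q 0) ^ 2 + (p 1 - q 1) ^ 2 + (p 2 - q 2) ^ 2 =
        ((1 - q 0) - (1 - p 0)) ^ 2 + (q 1 - p 1) ^ 2 := by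
      rw [hp.2, hq.2]; ring
    rw [e]
    exact oppositeTrailMin_le_add _ _ _ _ _ _

theorem one_sub_mem_Icc {x : ℝ} (hx : x ∈ Set.Icc (0 : ℝ) 1) : 1 - x ∈ Set.Icc (0 : ℝ) 1 :=
  ⟨sub_nonneg.2 hx.2, sub_le_self _ hx.1⟩

/-- The potentials of two faces agree on their common edge. -/
theorem facePotential_eq {x y : ℝ} (hx : x ∈ Set.Icc (0 : ℝ) 1) (hy : y ∈ Set.Icc (0 : ℝ) 1)
    {n m : CubeFace} {q : Space3} (hn : q ∈ n.carrier) (hm : q ∈ m.carrier) :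
    facePotential x y n q = facePotential x y m q := by
  have hq : ∀ i, q i ∈ Set.Icc (0 : ℝ) 1 := hn.1
  have hx' := one_sub_mem_Icc hx
  have hy' := one_sub_mem_Icc hy
  have hq' : ∀ i, 1 - q i ∈ Set.Icc (0 : ℝ) 1 := fun i => one_sub_mem_Icc (hq i)
  have e12 : q 2 = 1 → q 1 = 0 → facePotential x y F1 q = facePotential x y F2 q := by
    intro h2 h1
    simp only [facePotential, h1, h2, sub_self]
    rw [adjacentTrailMin_zero_right x y _ hx hy (hq' 0)]
    ring_nf
  have e13 : q 2 = 1 → q 0 = 0 → facePotential x y F1 q = facePotential x y F3 q := by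
    intro h2 h1
    simp only [facePotential, h1, h2, sub_self]
    rw [adjacentTrailMin_zero_right _ _ _ hy' hx (hq 1)]
    ring_nf
  have e14 : q 2 = 1 → q 0 = 1 → facePotential x y F1 q = facePotential x y F4 q := by
    intro h2 h1
    simp only [facePotential, h1, h2, sub_self]
    rw [adjacentTrailMin_zero_right _ _ _ hy hx' (hq' 1)]
    ring_nf
  have e15 : q 2 = 1 → q 1 = 1 → facePotential x y F1 q = facePotential x y F5 q := by
    intro h2 h1
    simp only [facePotential, h1, h2, sub_self]
    rw [adjacentTrailMin_zero_right _ _ _ hx' hy' (hq 0)]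
    ring_nf
  have e24 : q 1 = 0 → q 0 = 1 → facePotential x y F2 q = facePotential x y F4 q := by
    intro h1 h0
    simp only [facePotential, h1, h0, sub_self, sub_zero]
    exact adjacentTrailMin_side _ _ _ hx hy (hq' 2)
  have e45 : q 0 = 1 → q 1 = 1 → facePotential x y F4 q = facePotential x y F5 q := by
    intro h0 h1
    simp only [facePotential, h1, h0, sub_self]
    exact adjacentTrailMin_side _ _ _ hy hx' (hq' 2)
  have e53 : q 1 = 1 → q 0 = 0 → facePotential x y F5 q = facePotential x y F3 q := by
    intro h1 h0
    simp only [facePotential, h1, h0]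
    rw [adjacentTrailMin_side _ _ _ hx' hy' (hq' 2), sub_sub_cancel]
  have e32 : q 0 = 0 → q 1 = 0 → facePotential x y F3 q = facePotential x y F2 q := by
    intro h0 h1
    simp only [facePotential, h1, h0, sub_zero]
    rw [adjacentTrailMin_side _ _ _ hy' hx (hq' 2), sub_sub_cancel]
  have e62 : q 2 = 0 → q 1 = 0 → facePotential x y F6 q = facePotential x y F2 q := by
    intro h2 h1
    simp only [facePotential, h1, h2, sub_zero]
    exact oppositeTrailMin_zero_right _ _ _ hx hy (hq' 0)
  have e64 : q 2 = 0 → q 0 = 1 → facePotential x y F6 q = facePotential x y F4 q := by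
    intro h2 h0
    simp only [facePotential, h0, h2, sub_zero, sub_self]
    -- Quarter turns bring the other edges of `F6` to the position of its edge with `F2`: one for
    -- `F4`, two for `F5`, three for `F3`.
    rw [oppositeTrailMin_rotate]
    exact oppositeTrailMin_zero_right _ _ _ hy hx' (hq' 1)
  have e65 : q 2 = 0 → q 1 = 1 → facePotential x y F6 q = facePotential x y F5 q := by
    intro h2 h1
    simp only [facePotential, h1, h2, sub_zero]
    rw [oppositeTrailMin_rotate, oppositeTrailMin_rotate, sub_self, sub_sub_cancel]
    exact oppositeTrailMin_zero_right _ _ _ hx' hy' (hq 0)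
  have e63 : q 2 = 0 → q 0 = 0 → facePotential x y F6 q = facePotential x y F3 q := by
    intro h2 h0
    simp only [facePotential, h0, h2, sub_zero]
    rw [oppositeTrailMin_rotate, oppositeTrailMin_rotate, oppositeTrailMin_rotate, sub_self,
      sub_sub_cancel, sub_sub_cancel]
    exact oppositeTrailMin_zero_right _ _ _ hy' hx (hq 1)
  cases n <;> cases m <;> simp only [mem_carrier_F1, mem_carrier_F2, mem_carrier_F3,
    mem_carrier_F4, mem_carrier_F5, mem_carrier_F6] at hn hm
  -- In order: equal faces, opposite faces (a coordinate would be both 0 and 1), and adjacent faces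
  -- in either order.
  all_goals first
    | rfl
    | (exfalso; linarith [hn.2, hm.2])
    | solve_by_elim [hn.2, hm.2]
    | (symm; solve_by_elim [hn.2, hm.2])

/-- A face is chosen at each time; agreement on edges makes the potential independent of the choice,
so the preimages of the six faces are a closed cover as required. -/
theorem facePotential_le_eVariationOn {n : CubeFace} {p q : Space3} (hp : p ∈ F1.carrier)
    (hq : q ∈ n.carrier) (γ : Path p q) (hγ : ∀ t, γ t ∈ cubeSurface) :
    ENNReal.ofReal (facePotential (p 0) (p 1) n q) ≤ eVariationOn γ Set.univ := by
  classical
  have hp0 : p 0 ∈ Set.Icc (0 : ℝ) 1 := hp.1 0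
  have hp1 : p 1 ∈ Set.Icc (0 : ℝ) 1 := hp.1 1
  have hγ' : ∀ t, ∃ m : CubeFace, γ t ∈ m.carrier := fun t => Set.mem_iUnion.1 (hγ t)
  choose face hface using hγ'
  have hg : ∀ {m : CubeFace} {t}, γ t ∈ m.carrier →
      facePotential (p 0) (p 1) (face t) (γ t) = facePotential (p 0) (p 1) m (γ t) :=
    fun h => facePotential_eq hp0 hp1 (hface _) h
  have key := ofReal_sub_le_eVariationOn_of_cover γ
    (fun t => facePotential (p 0) (p 1) (face t) (γ t)) (fun m => γ ⁻¹' m.carrier)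
    (fun m => m.isClosed_carrier.preimage γ.continuous)
    (fun m s hs t ht => by
      rw [hg hs, hg ht, edist_dist]
      exact ENNReal.ofReal_le_ofReal (facePotential_sub_le_dist _ _ hs ht))
    {F1, F2, F3, F4, F5, F6} 0
    (fun t _ => ⟨face t, by cases face t <;> simp, Set.mem_preimage.2 (hface t)⟩)
  have h1 : γ 1 ∈ n.carrier := by rwa [γ.target]
  have h0 : γ 0 ∈ F1.carrier := by rwa [γ.source]
  rw [hg h1, hg h0, γ.target, γ.source] at key
  have hz : facePotential (p 0) (p 1) F1 p = 0 := by simp [facePotential]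
  rw [hz, sub_zero] at key
  exact key.trans (eVariationOn.mono _ (Set.subset_univ _))

/-! ### Upper bound -/

theorem represents_F1 {p : Space3} (hp : p ∈ F1.carrier) :
    Represents p F1 F2 (p 0) (p 1) ∧ Represents p F1 F3 (1 - p 1) (p 0) ∧
      Represents p F1 F4 (p 1) (1 - p 0) ∧ Represents p F1 F5 (1 - p 0) (1 - p 1) := by
  refine ⟨⟨⟨by simp, by simp [label]⟩, hp, ?_, ?_⟩, ⟨⟨by simp, by simp [label]⟩, hp, ?_, ?_⟩,
    ⟨⟨by simp, by simp [label]⟩, hp, ?_, ?_⟩, ⟨⟨by simp, by simp [label]⟩, hp, ?_, ?_⟩⟩ <;>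
  simp [normal, fromCentre, cross_apply, dotProduct, Fin.sum_univ_three] <;> ring1

theorem represents_F2 {p : Space3} (hp : p ∈ F2.carrier) :
    Represents p F2 F1 (1 - p 0) (1 - p 2) := by
  refine ⟨⟨by simp, by simp [label]⟩, hp, ?_, ?_⟩ <;>
  simp [normal, fromCentre, cross_apply, dotProduct, Fin.sum_univ_three]
  all_goals ring1

theorem represents_F3 {p : Space3} (hp : p ∈ F3.carrier) :
    Represents p F3 F1 (p 1) (1 - p 2) := by
  refine ⟨⟨by simp, by simp [label]⟩, hp, ?_, ?_⟩ <;>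
  simp [normal, fromCentre, cross_apply, dotProduct, Fin.sum_univ_three]
  ring1

theorem represents_F4 {p : Space3} (hp : p ∈ F4.carrier) :
    Represents p F4 F1 (1 - p 1) (1 - p 2) := by
  refine ⟨⟨by simp, by simp [label]⟩, hp, ?_, ?_⟩ <;>
  simp [normal, fromCentre, cross_apply, dotProduct, Fin.sum_univ_three] <;> ring1

theorem represents_F5 {p : Space3} (hp : p ∈ F5.carrier) :
    Represents p F5 F1 (p 0) (1 - p 2) := by
  refine ⟨⟨by simp, by simp [label]⟩, hp, ?_, ?_⟩ <;>
  simp [normal, fromCentre, cross_apply, dotProduct, Fin.sum_univ_three]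
  ring1

theorem forall_fin_three_mem_Icc {a b c : ℝ} (ha : a ∈ Set.Icc (0 : ℝ) 1)
    (hb : b ∈ Set.Icc (0 : ℝ) 1) (hc : c ∈ Set.Icc (0 : ℝ) 1) (i : Fin 3) :
    (!₂[a, b, c] : Space3) i ∈ Set.Icc (0 : ℝ) 1 := by
  fin_cases i <;> assumption

/-- The path that crosses the common edge directly. -/
theorem reachableWithin_direct {n m : CubeFace} {p q : Space3} {x₁ y₁ x₂ y₂ : ℝ}
    (hp : Represents p n m x₁ y₁) (hq : Represents q m n x₂ y₂) :
    ReachableWithin cubeSurface p q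
      (ENNReal.ofReal √((x₁ + x₂ - 1) ^ 2 + (y₁ + y₂) ^ 2)) := by
  apply reachableWithin_of_isSignedPermutation (isSignedPermutation_frameMap hp.1)
  obtain ⟨hp', rfl, rfl⟩ := hp.frameMap_home
  obtain ⟨hq', rfl, rfl⟩ := hq.frameMap_neighbour hp.1
  generalize frameMap n m p = p at hp'
  generalize frameMap n m q = q at hq'
  rw [mem_carrier_F1] at hp'
  rw [mem_carrier_F2] at hq'
  obtain ⟨hpi, hp2⟩ := hp'
  obtain ⟨hqi, hq1⟩ := hq'
  -- Unfolding `F2` into the plane of `F1` sends `q` to `(q 0, q 2 - 1)`; the segment meets the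
  -- common edge where its height vanishes.
  obtain ⟨t, ht0, ht1, ht⟩ := exists_eq_zero_of_sign_change
    (m := fun t => (1 - t) * p 1 + t * (q 2 - 1)) (by fun_prop)
    (by simpa using (hpi 1).1) (by simpa using (hqi 2).2)
  have he := (convex_Icc (0 : ℝ) 1) (hpi 0) (hqi 0) (sub_nonneg.2 ht1) ht0 (by ring)
  simp only [smul_eq_mul] at he
  set e : Space3 := !₂[(1 - t) * p 0 + t * q 0, 0, 1] with hedef
  have hei : ∀ i, e i ∈ Set.Icc (0 : ℝ) 1 := forall_fin_three_mem_Icc he (by simp) (by simp)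
  have hs := sqrt_eq_add_of_convex (p 0) (p 1) (q 0) (q 2 - 1) t (e 0) 0 ht0 ht1 rfl ht.symm
  have h1 := reachableWithin_face (mem_carrier_F1.2 ⟨hpi, hp2⟩) (mem_carrier_F1.2 ⟨hei, rfl⟩)
  have h2 := reachableWithin_face (mem_carrier_F2.2 ⟨hei, rfl⟩) (mem_carrier_F2.2 ⟨hqi, hq1⟩)
  refine (h1.trans h2).mono ?_
  rw [← ENNReal.ofReal_add dist_nonneg dist_nonneg]
  apply ENNReal.ofReal_le_ofReal
  have e1 : e 1 = 0 := rfl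
  have e2 : e 2 = 1 := rfl
  have h3 : (p 0 + (1 - q 0) - 1) ^ 2 + (p 1 + (1 - q 2)) ^ 2 =
    (p 0 - q 0) ^ 2 + (p 1 - (q 2 - 1)) ^ 2 := by ring
  rw [h3, hs, dist_space3, dist_space3, e1, e2, hp2, hq1]
  apply le_of_eq
  ring_nf

theorem reachableWithin_adjacent_front_bottom {p q : Space3} (hp : p ∈ F1.carrier)
    (hq : q ∈ F2.carrier) : ReachableWithin cubeSurface p q
      (ENNReal.ofReal (adjacentTrailMin (p 0) (p 1) (1 - q 0) (1 - q 2))) := by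
  obtain ⟨hrep2, hrep3, hrep4, -⟩ := represents_F1 hp
  have hpi : ∀ i, p i ∈ Set.Icc (0 : ℝ) 1 := hp.1
  have hqi : ∀ i, q i ∈ Set.Icc (0 : ℝ) 1 := hq.1
  have hp2 := (mem_carrier_F1.1 hp).2
  have hq1 := (mem_carrier_F2.1 hq).2
  obtain ⟨hpx0, hpx1⟩ := hpi 0
  obtain ⟨hpy0, hpy1⟩ := hpi 1
  have finish : ∀ (e : Space3) (r s : ℝ), e ∈ F2.carrier → 0 ≤ r →
      ReachableWithin cubeSurface p e (ENNReal.ofReal r) → r + dist e q ≤ s →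
      ReachableWithin cubeSurface p q (ENNReal.ofReal s) := fun e r s he hr h hs =>
    (h.trans (reachableWithin_face he hq)).mono (by
      rw [← ENNReal.ofReal_add hr dist_nonneg]
      exact ENNReal.ofReal_le_ofReal hs)
  rw [adjacentTrailMin]
  refine min_rec' (fun r => ReachableWithin cubeSurface p q (ENNReal.ofReal r))
    (reachableWithin_direct hrep2 (represents_F2 hq))
    (min_rec' (fun r => ReachableWithin cubeSurface p q (ENNReal.ofReal r)) ?_ ?_)
  · obtain ⟨t, ht0, ht1, hu, hv, huv⟩ := exists_quadrant_crossing (q 0) (1 - q 2) (-p 1) (-p 0)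
      (hqi 0).1 (sub_nonneg.2 (hqi 2).2) (Or.inl (by linarith))
    have hs := sqrt_eq_add_of_convex (q 0) (1 - q 2) (-p 1) (-p 0) t _ _ ht0 ht1 rfl rfl
    have hu1 : (1 - t) * q 0 + t * -p 1 ≤ 1 := by
      nlinarith [mul_nonneg (sub_nonneg.2 ht1) (sub_nonneg.2 (hqi 0).2), mul_nonneg ht0 hpy0]
    have hv1 : (1 - t) * (1 - q 2) + t * -p 0 ≤ 1 := by
      nlinarith [mul_nonneg (sub_nonneg.2 ht1) (hqi 2).1, mul_nonneg ht0 hpx0]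
    generalize (1 - t) * q 0 + t * -p 1 = u at *
    generalize (1 - t) * (1 - q 2) + t * -p 0 = v at *
    have hei : ∀ i, (!₂[u, 0, 1 - v] : Space3) i ∈ Set.Icc (0 : ℝ) 1 :=
      forall_fin_three_mem_Icc ⟨hu, hu1⟩ (by simp) (one_sub_mem_Icc ⟨hv, hv1⟩)
    have he2 : (!₂[u, 0, 1 - v] : Space3) ∈ F2.carrier := mem_carrier_F2.2 ⟨hei, rfl⟩
    have hL : (p 0 + (1 - q 2)) ^ 2 + (p 1 - (1 - q 0) + 1) ^ 2 =
      (q 0 - -p 1) ^ 2 + (1 - q 2 - -p 0) ^ 2 := by ring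
    have hd : dist (!₂[u, 0, 1 - v] : Space3) q = √((q 0 - u) ^ 2 + (1 - q 2 - v) ^ 2) := by
      rw [dist_space3, hq1]
      congr 1
      simp only [Matrix.cons_val]
      ring
    rw [hL, hs]
    rcases huv with rfl | rfl
    · refine finish _ _ _ he2 (Real.sqrt_nonneg _)
        (reachableWithin_direct hrep3 (represents_F3 (mem_carrier_F3.2 ⟨hei, rfl⟩))) ?_
      rw [hd, add_comm]
      refine add_le_add le_rfl (Real.sqrt_le_sqrt (le_of_eq ?_))
      simp only [Matrix.cons_val]
      ring
    -- The segment leaves through the edge with `F1`, and from there going straight across `F1` is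
    -- no longer than the rest of the trail.
    · refine finish _ _ _ he2 dist_nonneg
        (reachableWithin_face hp (mem_carrier_F1.2 ⟨hei, by simp⟩)) ?_
      rw [hd, add_comm, dist_space3, hp2]
      refine add_le_add le_rfl (Real.sqrt_le_sqrt ?_)
      simp only [Matrix.cons_val]
      nlinarith [mul_nonneg hu hpx0, mul_nonneg hu hpy0]
  -- The mirror image of the previous case, with `F4` in place of `F3`.
  · obtain ⟨t, ht0, ht1, hu, hv, huv⟩ := exists_quadrant_crossing (1 - q 0) (1 - q 2) (-p 1)
      (-(1 - p 0)) (sub_nonneg.2 (hqi 0).2) (sub_nonneg.2 (hqi 2).2) (Or.inl (by linarith))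
    have hs := sqrt_eq_add_of_convex (1 - q 0) (1 - q 2) (-p 1) (-(1 - p 0)) t _ _ ht0 ht1 rfl rfl
    have hu1 : (1 - t) * (1 - q 0) + t * -p 1 ≤ 1 := by
      nlinarith [mul_nonneg (sub_nonneg.2 ht1) (hqi 0).1, mul_nonneg ht0 hpy0]
    have hv1 : (1 - t) * (1 - q 2) + t * -(1 - p 0) ≤ 1 := by
      nlinarith [mul_nonneg (sub_nonneg.2 ht1) (hqi 2).1, mul_nonneg ht0 (sub_nonneg.2 hpx1)]
    generalize (1 - t) * (1 - q 0) + t * -p 1 = u at *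
    generalize (1 - t) * (1 - q 2) + t * -(1 - p 0) = v at *
    have hei : ∀ i, (!₂[1 - u, 0, 1 - v] : Space3) i ∈ Set.Icc (0 : ℝ) 1 :=
      forall_fin_three_mem_Icc (one_sub_mem_Icc ⟨hu, hu1⟩) (by simp) (one_sub_mem_Icc ⟨hv, hv1⟩)
    have he2 : (!₂[1 - u, 0, 1 - v] : Space3) ∈ F2.carrier := mem_carrier_F2.2 ⟨hei, rfl⟩
    have hL : (p 0 - (1 - q 2) - 1) ^ 2 + (p 1 + (1 - q 0)) ^ 2 =
      (1 - q 0 - -p 1) ^ 2 + (1 - q 2 - -(1 - p 0)) ^ 2 := by ring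
    have hd : dist (!₂[1 - u, 0, 1 - v] : Space3) q =
        √((1 - q 0 - u) ^ 2 + (1 - q 2 - v) ^ 2) := by
      rw [dist_space3, hq1]
      congr 1
      simp only [Matrix.cons_val]
      ring
    rw [hL, hs]
    rcases huv with rfl | rfl
    · refine finish _ _ _ he2 (Real.sqrt_nonneg _)
        (reachableWithin_direct hrep4 (represents_F4 (mem_carrier_F4.2 ⟨hei, by simp⟩))) ?_
      rw [hd, add_comm]
      refine add_le_add le_rfl (Real.sqrt_le_sqrt (le_of_eq ?_))
      simp only [Matrix.cons_val]
      ring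
    · refine finish _ _ _ he2 dist_nonneg
        (reachableWithin_face hp (mem_carrier_F1.2 ⟨hei, by simp⟩)) ?_
      rw [hd, add_comm, dist_space3, hp2]
      refine add_le_add le_rfl (Real.sqrt_le_sqrt ?_)
      simp only [Matrix.cons_val]
      nlinarith [mul_nonneg hu (sub_nonneg.2 hpx1), mul_nonneg hu hpy0]

theorem reachableWithin_adjacent {n m : CubeFace} {p q : Space3} {x₁ y₁ x₂ y₂ : ℝ}
    (hp : Represents p n m x₁ y₁) (hq : Represents q m n x₂ y₂) :
    ReachableWithin cubeSurface p q (ENNReal.ofReal (adjacentTrailMin x₁ y₁ x₂ y₂)) := by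
  apply reachableWithin_of_isSignedPermutation (isSignedPermutation_frameMap hp.1)
  obtain ⟨hp', rfl, rfl⟩ := hp.frameMap_home
  obtain ⟨hq', rfl, rfl⟩ := hq.frameMap_neighbour hp.1
  exact reachableWithin_adjacent_front_bottom hp' hq'

theorem reachableWithin_opposite {p q : Space3} (hp : p ∈ F1.carrier) (hq : q ∈ F6.carrier) :
    ReachableWithin cubeSurface p q
      (ENNReal.ofReal (oppositeTrailMin (p 0) (p 1) (1 - q 0) (q 1))) := by
  obtain ⟨hrep2, hrep3, hrep4, hrep5⟩ := represents_F1 hp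
  have hpi : ∀ i, p i ∈ Set.Icc (0 : ℝ) 1 := hp.1
  have hqi : ∀ i, q i ∈ Set.Icc (0 : ℝ) 1 := hq.1
  have hq2 := (mem_carrier_F6.1 hq).2
  obtain ⟨hpx0, hpx1⟩ := hpi 0
  obtain ⟨hpy0, hpy1⟩ := hpi 1
  -- `T` is a squared trail length as a function of the endpoint in `F6`, and `(a, b)` is the image
  -- of `p` unfolded into that plane, always outside the open square.
  have key : ∀ (T : ℝ → ℝ → ℝ) (a b : ℝ), (a ≤ 0 ∨ 1 ≤ a ∨ b ≤ 0 ∨ 1 ≤ b) →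
      (∀ u v, T u v = (u - a) ^ 2 + (v - b) ^ 2) →
      (∀ u v, oppositeTrailMin (p 0) (p 1) (1 - u) v ≤ √(T u v)) →
      ReachableWithin cubeSurface p q (ENNReal.ofReal √(T (q 0) (q 1))) := by
    intro T a b hab hT hmin
    simp only [hT] at hmin ⊢
    obtain ⟨u, v, hu, hv, huv, hs⟩ := exists_square_crossing (q 0) (q 1) a b (hqi 0) (hqi 1) hab
    have hei : ∀ i, (!₂[u, v, 0] : Space3) i ∈ Set.Icc (0 : ℝ) 1 :=
      forall_fin_three_mem_Icc hu hv (by simp)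
    have he6 : (!₂[u, v, 0] : Space3) ∈ F6.carrier := mem_carrier_F6.2 ⟨hei, rfl⟩
    have hd : dist (!₂[u, v, 0] : Space3) q = √((q 0 - u) ^ 2 + (q 1 - v) ^ 2) := by
      rw [dist_space3, hq2]
      congr 1
      simp only [Matrix.cons_val]
      ring
    obtain ⟨k, hk, hr⟩ : ∃ k : CubeFace, (!₂[u, v, 0] : Space3) ∈ k.carrier ∧
        ReachableWithin cubeSurface p !₂[u, v, 0]
          (ENNReal.ofReal (facePotential (p 0) (p 1) k !₂[u, v, 0])) := by
      rcases huv with h | h | h | h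
      · have he := mem_carrier_F3.2 ⟨hei, h⟩
        exact ⟨F3, he, reachableWithin_adjacent hrep3 (represents_F3 he)⟩
      · have he := mem_carrier_F4.2 ⟨hei, h⟩
        exact ⟨F4, he, reachableWithin_adjacent hrep4 (represents_F4 he)⟩
      · have he := mem_carrier_F2.2 ⟨hei, h⟩
        exact ⟨F2, he, reachableWithin_adjacent hrep2 (represents_F2 he)⟩
      · have he := mem_carrier_F5.2 ⟨hei, h⟩
        exact ⟨F5, he, reachableWithin_adjacent hrep5 (represents_F5 he)⟩
    -- At the crossing point the adjacent minimum equals the opposite one, hence is at most the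
    -- trail `T` under consideration, whatever edge was crossed.
    rw [facePotential_eq (hpi 0) (hpi 1) hk he6] at hr
    have hr' := hr.mono (ENNReal.ofReal_le_ofReal (hmin u v))
    refine (hr'.trans (reachableWithin_face he6 hq)).mono ?_
    rw [← ENNReal.ofReal_add (Real.sqrt_nonneg _) dist_nonneg, hs, hd, add_comm]
  have hmin : ∀ {a b : ℝ}, ReachableWithin cubeSurface p q (ENNReal.ofReal a) →
      ReachableWithin cubeSurface p q (ENNReal.ofReal b) →
      ReachableWithin cubeSurface p q (ENNReal.ofReal (min a b)) :=
    fun ha hb => min_rec' (fun r => ReachableWithin cubeSurface p q (ENNReal.ofReal r)) ha hb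
  generalize hx : p 0 = x at *
  generalize hy : p 1 = y at *
  have hr : ∀ {a b c : ℝ}, b ≤ c → min a b ≤ c := min_le_of_right_le
  rw [oppositeTrailMin]
  refine hmin ?_ <| hmin ?_ <| hmin ?_ <| hmin ?_ <| hmin ?_ <| hmin ?_ <| hmin ?_ <|
    hmin ?_ <| hmin ?_ <| hmin ?_ <| hmin ?_ ?_
  · exact key (fun u v => (x + (1 - u) - 1) ^ 2 + (y + v + 1) ^ 2)
      x (-1 - y) (.inr (.inr (.inl (by linarith))))
      (fun u v => by ring) (fun u v => min_le_left _ _)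
  · exact key (fun u v => (y - v) ^ 2 + (x - (1 - u) + 2) ^ 2)
      (-1 - x) y (.inl (by linarith))
      (fun u v => by ring) (fun u v => hr <| min_le_left _ _)
  · exact key (fun u v => (y - v) ^ 2 + (x - (1 - u) - 2) ^ 2)
      (3 - x) y (.inr (.inl (by linarith)))
      (fun u v => by ring) (fun u v => hr <| hr <| min_le_left _ _)
  · exact key (fun u v => (x + (1 - u) - 1) ^ 2 + (y + v - 3) ^ 2)
      x (3 - y) (.inr (.inr (.inr (by linarith))))
      (fun u v => by ring) (fun u v => hr <| hr <| hr <| min_le_left _ _)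
  · exact key (fun u v => (x + v) ^ 2 + (y - (1 - u) + 2) ^ 2)
      (-1 - y) (-x) (.inl (by linarith))
      (fun u v => by ring) (fun u v => hr <| hr <| hr <| hr <| min_le_left _ _)
  · exact key (fun u v => (y + (1 - u) - 2) ^ 2 + (x - v + 2) ^ 2)
      (y - 1) (x + 2) (.inr (.inr (.inr (by linarith))))
      (fun u v => by ring) (fun u v => hr <| hr <| hr <| hr <| hr <| min_le_left _ _)
  · exact key (fun u v => (x + v - 2) ^ 2 + (y - (1 - u) - 2) ^ 2)
      (3 - y) (2 - x) (.inr (.inl (by linarith)))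
      (fun u v => by ring) (fun u v => hr <| hr <| hr <| hr <| hr <| hr <| min_le_left _ _)
  · exact key (fun u v => (y + (1 - u)) ^ 2 + (x - v - 2) ^ 2)
      (y + 1) (x - 2) (.inr (.inr (.inl (by linarith))))
      (fun u v => by ring) (fun u v => hr <| hr <| hr <| hr <| hr <| hr <| hr <| min_le_left _ _)
  · exact key (fun u v => (x - v - 1) ^ 2 + (y + (1 - u) + 1) ^ 2)
      (y + 2) (x - 1) (.inr (.inl (by linarith)))
      (fun u v => by ring)
      (fun u v => hr <| hr <| hr <| hr <| hr <| hr <| hr <| hr <| min_le_left _ _)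
  · exact key (fun u v => (y - (1 - u) + 1) ^ 2 + (x + v + 1) ^ 2)
      (-y) (-1 - x) (.inr (.inr (.inl (by linarith))))
      (fun u v => by ring)
      (fun u v => hr <| hr <| hr <| hr <| hr <| hr <| hr <| hr <| hr <| min_le_left _ _)
  · exact key (fun u v => (x - v + 1) ^ 2 + (y + (1 - u) - 3) ^ 2)
      (y - 2) (x + 1) (.inl (by linarith))
      (fun u v => by ring)
      (fun u v => hr <| hr <| hr <| hr <| hr <| hr <| hr <| hr <| hr <| hr <| min_le_left _ _)
  · exact key (fun u v => (y - (1 - u) - 1) ^ 2 + (x + v - 3) ^ 2)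
      (2 - y) (3 - x) (.inr (.inr (.inr (by linarith))))
      (fun u v => by ring)
      (fun u v => hr <| hr <| hr <| hr <| hr <| hr <| hr <| hr <| hr <| hr <| min_le_right _ _)

/-! ### The surface distance -/

theorem surfaceDist_eq_of_bounds {p q : Space3} {r : ℝ≥0∞}
    (hr : ReachableWithin cubeSurface p q r)
    (hle : ∀ γ : Path p q, (∀ t, γ t ∈ cubeSurface) → r ≤ eVariationOn γ Set.univ) :
    surfaceDist p q = r ∧ surfaceDist p q ∈ surfacePathLengths p q := by
  obtain ⟨γ, hγ, hl⟩ := hr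
  have hmem : r ∈ surfacePathLengths p q := ⟨γ, hγ, hl.antisymm (hle γ hγ)⟩
  have h : surfaceDist p q = r := by
    refine le_antisymm (sInf_le hmem) (le_sInf ?_)
    rintro _ ⟨δ, hδ, rfl⟩
    exact hle δ hδ
  exact ⟨h, h ▸ hmem⟩

/-- The image of a surface path under the symmetry is a surface path of no greater length, so a
lower bound in the standard position transfers back. -/
theorem le_eVariationOn_of_isSignedPermutation {f : Space3 → Space3}
    (hf : IsSignedPermutation f) {p q : Space3} {r : ℝ≥0∞}
    (h : ∀ γ : Path (f p) (f q), (∀ t, γ t ∈ cubeSurface) → r ≤ eVariationOn γ Set.univ)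
    (γ : Path p q) (hγ : ∀ t, γ t ∈ cubeSurface) : r ≤ eVariationOn γ Set.univ := by
  obtain ⟨δ, hδ, hl⟩ := ReachableWithin.map (⟨γ, hγ, le_rfl⟩ :
    ReachableWithin cubeSurface p q _) hf.isometry.lipschitz hf.mapsTo
  exact (h δ hδ).trans hl

theorem mainTheorem2 :
    (∀ (n m : CubeFace) (p₁ p₂ : Space3) (x₁ y₁ x₂ y₂ : ℝ),
      n ≠ m → n.label + m.label ≠ 7 →
      p₁ ∈ n.carrier \ m.carrier → p₂ ∈ m.carrier \ n.carrier →
      CubeFace.Represents p₁ n m x₁ y₁ → CubeFace.Represents p₂ m n x₂ y₂ →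
      surfaceDist p₁ p₂ = ENNReal.ofReal (adjacentTrailMin x₁ y₁ x₂ y₂) ∧
        surfaceDist p₁ p₂ ∈ surfacePathLengths p₁ p₂) ∧
    (∀ (n m k : CubeFace) (p₁ p₂ : Space3) (x₁ y₁ x₂ y₂ : ℝ),
      n.label + m.label = 7 →
      p₁ ∈ n.interior → p₂ ∈ m.interior →
      CubeFace.Represents p₁ n k x₁ y₁ → CubeFace.Represents p₂ m k x₂ y₂ →
      surfaceDist p₁ p₂ = ENNReal.ofReal (oppositeTrailMin x₁ y₁ x₂ y₂) ∧
        surfaceDist p₁ p₂ ∈ surfacePathLengths p₁ p₂) := by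
  constructor
  · intro n m p q x₁ y₁ x₂ y₂ _ _ _ _ hp hq
    refine surfaceDist_eq_of_bounds (reachableWithin_adjacent hp hq) ?_
    apply le_eVariationOn_of_isSignedPermutation (isSignedPermutation_frameMap hp.1)
    obtain ⟨hp', rfl, rfl⟩ := hp.frameMap_home
    obtain ⟨hq', rfl, rfl⟩ := hq.frameMap_neighbour hp.1
    exact facePotential_le_eVariationOn hp' hq'
  · intro n m k p q x₁ y₁ x₂ y₂ hnm _ _ hp hq
    have hf := isSignedPermutation_frameMap hp.1
    obtain ⟨hp', rfl, rfl⟩ := hp.frameMap_home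
    obtain ⟨hq', rfl, rfl⟩ := hq.frameMap_opposite hp.1 hnm
    exact surfaceDist_eq_of_bounds
      (reachableWithin_of_isSignedPermutation hf (reachableWithin_opposite hp' hq'))
      (le_eVariationOn_of_isSignedPermutation hf (facePotential_le_eVariationOn hp' hq'))
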